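/- For an integer $t\ge 3$ let $P_t^+$ be the graph obtained from the path $v_1v_2\cdots v_t$ on $t$ vertices by adding the edge $v_1v_3$ (so that $v_1v_2v_3$ is a triangle). For graphs $G$ and $H$ let $R(G,H)$ be the least number $n$ such that every coloring of the edges of the complete graph $K_n$ with the colors red and blue contains a red copy of $G$ or a blue copy of $H$ (as a not necessarily induced subgraph). Then for every integer $t\ge 4$, $$R(P_t^+,P_t^+)=2t-1.$$ -/

import Mathlib

/-- The graph `P_t^+` on the vertices `0, 1, …, t - 1`: the path `0 - 1 - ⋯ - (t - 1)` together with
the extra edge `0 - 2` joining an end of the path to the vertex at distance two from it. -/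
def pathPlus (t : ℕ) : SimpleGraph (Fin t) :=
  SimpleGraph.fromRel fun i j => i.val + 1 = j.val ∨ (i.val = 0 ∧ j.val = 2)

/-- Every red-blue coloring of the edges of the complete graph on `n` vertices contains a red copy
of `G` or a blue copy of `H`. A coloring is given by its red graph `R`; its blue graph is the
complement `Rᶜ`. A copy is a not necessarily induced subgraph. -/
def RamseyArrows (n : ℕ) {V W : Type*} (G : SimpleGraph V) (H : SimpleGraph W) : Prop :=
  ∀ R : SimpleGraph (Fin n), G.IsContained R ∨ H.IsContained Rᶜ

/-- `r` is the 2-color Ramsey number `R(G, H)`: the least `n` such that every red-blue coloring of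
the complete graph on `n` vertices contains a red copy of `G` or a blue copy of `H`. -/
def IsRamseyNumber {V W : Type*} (G : SimpleGraph V) (H : SimpleGraph W) (r : ℕ) : Prop :=
  IsLeast {n : ℕ | RamseyArrows n G H} r

/-!
Two disjoint red cliques on `t - 1` vertices each, joined in blue, show `R(P_t⁺, P_t⁺) > 2t - 2`.

For the upper bound, induct on `t`. A red `P_{t-1}⁺` is a red triangle `abc` with a red path
leaving `c` outside `{a, b}`. Search the red graph depth first from `c` in the complement of
`{a, b}`, starting with this path as the active one. All edges between the finished vertices and
the unvisited ones are blue, and a blue complete bipartite graph with two large parts contains no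
blue `P_t⁺` only if both parts are red cliques. The search is stopped as soon as there are as many
finished vertices as unvisited ones. The two red cliques then cannot be attached to the active
path without creating a red `P_t⁺`, so the current vertex is blue to both, and it can be moved
into the finished part, which would then be a red clique, a contradiction. If the search ends
earlier, the unvisited vertices form a red clique, so there are fewer than `t` of them; the many
vertices it reached then form a red clique containing `c`, and going through this clique after `a`
and `b` gives a red `P_t⁺`.
-/

open Finset SimpleGraph

section LowerBound

variable {V W C : Type*}

theorem eq_of_forall_adj_eq {G : SimpleGraph V} (hG : G.Preconnected) {f : V → C}
    (hf : ∀ u v, G.Adj u v → f u = f v) (u v : V) : f u = f v := by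
  obtain ⟨p⟩ := hG u v
  induction p with
  | nil => rfl
  | cons huw _ ih => exact (hf _ _ huw).trans ih

/-- Split the vertices into `c` red cliques of `card V - 1` vertices each: the red components are
too small for the connected graph `G`, and the blue graph is `c`-partite. -/
theorem not_ramseyArrows_of_connected [Fintype V] {G : SimpleGraph V} {H : SimpleGraph W}
    {c n : ℕ} (hG : G.Connected) (hH : ¬H.Colorable c) (hn : n ≤ c * (Fintype.card V - 1)) :
    ¬RamseyArrows n G H := by
  intro hn'
  let e : Fin n ↪ Fin c × Fin (Fintype.card V - 1) :=
    (Fin.castLEEmb hn).trans finProdFinEquiv.symm.toEmbedding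
  let blue : SimpleGraph (Fin n) := (⊤ : SimpleGraph (Fin c)).comap fun v => (e v).1
  rcases hn' blueᶜ with ⟨⟨φ⟩⟩ | h
  · have hfst : ∀ u v, (e (φ u)).1 = (e (φ v)).1 :=
      eq_of_forall_adj_eq hG.preconnected (f := fun v => (e (φ v)).1) fun u v huv => by
        simpa [blue] using (φ.toHom.map_adj huv).2
    have hinj : Function.Injective fun v => (e (φ v)).2 := fun u v huv =>
      φ.injective (e.injective (Prod.ext (hfst u v) huv))
    have hcard := Fintype.card_le_of_injective _ hinj
    have := hG.nonempty
    have := Fintype.card_pos (α := V)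
    rw [Fintype.card_fin] at hcard
    omega
  · rw [compl_compl] at h
    obtain ⟨φ⟩ := h
    exact hH ⟨(Hom.comap _ _).comp φ.toHom⟩

end LowerBound

section PathPlus

variable {V : Type*} {G : SimpleGraph V} {s t : ℕ}

theorem pathGraph_le_pathPlus (t : ℕ) : pathGraph t ≤ pathPlus t := by
  intro i j hij
  rw [pathGraph_adj] at hij
  rw [pathPlus, fromRel_adj]
  exact ⟨by rintro rfl; omega, hij.imp Or.inl Or.inl⟩

theorem pathPlus_connected (ht : t ≠ 0) : (pathPlus t).Connected := by
  obtain ⟨n, rfl⟩ := Nat.exists_eq_succ_of_ne_zero ht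
  exact (pathGraph_connected n).mono (pathGraph_le_pathPlus _)

theorem not_colorable_two_pathPlus (ht : 3 ≤ t) : ¬(pathPlus t).Colorable 2 := by
  intro hcol
  refine hcol.cliqueFree (m := 3) (by norm_num)
    {⟨0, by omega⟩, ⟨1, by omega⟩, ⟨2, by omega⟩} (is3Clique_triple_iff.2 ?_)
  simp [pathPlus]

theorem pathPlus_isContained_pathPlus (hst : s ≤ t) : pathPlus s ⊑ pathPlus t :=
  ⟨⟨Fin.castLE hst, fun {i j} hij => by simpa [pathPlus, Fin.ext_iff] using hij⟩,
    Fin.castLE_injective hst⟩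

theorem pathPlus_isContained_of_isClique {T : Finset V} (hT : G.IsClique T) (ht : t ≤ #T) :
    pathPlus t ⊑ G := by
  obtain ⟨T', hT'T, hT'⟩ := exists_subset_card_eq ht
  have hfree : ¬G.CliqueFree t := fun h => h T' ⟨hT.subset (coe_subset.2 hT'T), hT'⟩
  exact ((not_cliqueFree_iff_top_isContained t).1 hfree).mono_left le_top

theorem pathPlus_isContained_of_isPath {a b c d : V} (hab : G.Adj a b) (hac : G.Adj a c)
    (hbc : G.Adj b c) {p : G.Walk d c} (hp : p.IsPath) (ha : a ∉ p.support) (hb : b ∉ p.support)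
    (ht : t ≤ p.length + 3) : pathPlus t ⊑ G := by
  let q : G.Walk a d := .cons hab (.cons hbc p.reverse)
  have hq : q.IsPath := by simp [q, Walk.cons_isPath_iff, hp, ha, hb, hab.ne]
  have hlen : t ≤ q.length + 1 := by simpa [q] using ht
  have hadj : ∀ i j : Fin t, i.val + 1 = j.val ∨ i.val = 0 ∧ j.val = 2 →
      G.Adj (q.getVert i) (q.getVert j) := by
    rintro ⟨i, hi⟩ ⟨j, hj⟩ (rfl | ⟨rfl, rfl⟩)
    · exact q.adj_getVert_succ (by omega)
    · simpa [q] using hac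
  refine ⟨⟨fun i => q.getVert i, fun {i j} hij => ?_⟩, fun i j hij => ?_⟩
  · rw [pathPlus, fromRel_adj] at hij
    exact hij.2.elim (hadj i j) fun h => (hadj j i h).symm
  · refine Fin.ext (hq.getVert_injOn ?_ ?_ hij) <;> simp <;> omega

theorem exists_isPath_of_pathPlus_isContained (ht : 3 ≤ t) (h : pathPlus t ⊑ G) :
    ∃ (a b c d : V) (p : G.Walk d c), G.Adj a b ∧ G.Adj a c ∧ G.Adj b c ∧ p.IsPath ∧
      a ∉ p.support ∧ b ∉ p.support ∧ p.length + 3 = t := by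
  obtain ⟨φ⟩ := h
  obtain ⟨n, rfl⟩ := Nat.exists_eq_add_of_le' ht
  have hadj : ∀ i j, (pathPlus (n + 3)).Adj i j → G.Adj (φ i) (φ j) := fun _ _ => φ.toHom.map_adj
  have hac : G.Adj (φ 0) (φ 2) := hadj ⟨0, by omega⟩ ⟨2, by omega⟩ (by simp [pathPlus])
  have hchain : (List.ofFn φ).IsChain G.Adj :=
    List.isChain_ofFn.2 fun i hi => hadj _ _ (by simp [pathPlus])
  have hnodup : (List.ofFn φ).Nodup := List.nodup_ofFn.2 φ.injective
  obtain ⟨l, hl, hlen⟩ : ∃ l, List.ofFn φ = φ 0 :: φ 1 :: φ 2 :: l ∧ l.length = n :=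
    ⟨_, by rw [List.ofFn_succ, List.ofFn_succ, List.ofFn_succ]; rfl, List.length_ofFn⟩
  rw [hl, List.isChain_cons_cons, List.isChain_cons_cons] at hchain
  rw [hl, List.nodup_cons, List.nodup_cons] at hnodup
  obtain ⟨hab, hbc, hchain⟩ := hchain
  obtain ⟨ha, hb, hnodup⟩ := hnodup
  obtain ⟨d, p, hp⟩ : ∃ (d : V) (p : G.Walk (φ 2) d), p.support = φ 2 :: l :=
    ⟨_, Walk.ofSupport _ (List.cons_ne_nil _ _) hchain, Walk.support_ofSupport ..⟩
  have hplen : p.length = n := by simpa [hp, hlen] using p.length_support.symm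
  refine ⟨φ 0, φ 1, φ 2, d, p.reverse, hab, hac, hbc, ?_, ?_, ?_, ?_⟩
  · rwa [Walk.isPath_reverse_iff, Walk.isPath_def, hp]
  · rw [Walk.support_reverse, hp, List.mem_reverse]
    exact fun h => ha (List.mem_cons_of_mem _ h)
  · rwa [Walk.support_reverse, hp, List.mem_reverse]
  · rw [Walk.length_reverse, hplen]

end PathPlus

section CompleteBetween

variable {V : Type*} {G : SimpleGraph V} {A B : Finset V} {t : ℕ}

theorem exists_isPath_of_isCompleteBetween (hAB : G.IsCompleteBetween (A : Set V) B) {a : V}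
    (ha : a ∈ A) {n : ℕ} (hA : n + 1 ≤ 2 * #A) (hB : n ≤ 2 * #B) :
    ∃ (x : V) (p : G.Walk a x), p.IsPath ∧ p.length = n ∧ ∀ v ∈ p.support, v ∈ A ∨ v ∈ B := by
  classical
  induction n generalizing A B a with
  | zero => exact ⟨a, .nil, .nil, rfl, by simp [ha]⟩
  | succ n ih =>
    obtain ⟨b, hb⟩ : B.Nonempty := card_pos.1 (by omega)
    have hBA : G.IsCompleteBetween (B : Set V) (A.erase a : Finset V) :=
      fun u hu v hv => (hAB (mem_of_mem_erase hv) hu).symm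
    have hcard := card_erase_add_one ha
    obtain ⟨x, p, hp, hlen, hsupp⟩ := ih hBA hb (by omega) (by omega)
    have haB : a ∉ B := disjoint_left.1 (disjoint_coe.1 hAB.disjoint) ha
    refine ⟨x, .cons (hAB ha hb) p, hp.cons fun h => ?_, by simp [hlen], ?_⟩
    · simpa [haB] using hsupp a h
    · simp only [Walk.support_cons, List.mem_cons, forall_eq_or_imp]
      grind

theorem pathPlus_isContained_of_isCompleteBetween (hAB : G.IsCompleteBetween (A : Set V) B)
    {d e : V} (hd : d ∈ A) (he : e ∈ A) (hde : G.Adj d e) (ht : 3 ≤ t) (hA : t ≤ 2 * #A)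
    (hB : t ≤ 2 * #B + 1) : pathPlus t ⊑ G := by
  classical
  obtain ⟨z, hz⟩ : B.Nonempty := card_pos.1 (by omega)
  have hAB' : G.IsCompleteBetween (A.erase d : Finset V) (B.erase z : Finset V) :=
    fun u hu v hv => hAB (mem_of_mem_erase hu) (mem_of_mem_erase hv)
  have hcardA := card_erase_add_one hd
  have hcardB := card_erase_add_one hz
  obtain ⟨x, p, hp, hlen, hsupp⟩ := exists_isPath_of_isCompleteBetween hAB'
    (mem_erase.2 ⟨hde.ne', he⟩) (n := t - 3) (by omega) (by omega)
  have hdisj := disjoint_left.1 (disjoint_coe.1 hAB.disjoint)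
  refine pathPlus_isContained_of_isPath (hAB hd hz) hde (hAB he hz).symm hp.reverse
    (fun h => ?_) (fun h => ?_) (by rw [Walk.length_reverse]; omega)
  · have := hsupp d (by simpa using h)
    grind
  · have := hsupp z (by simpa using h)
    grind

theorem isClique_of_isCompleteBetween_compl (hfree : (pathPlus t).Free Gᶜ)
    (hAB : Gᶜ.IsCompleteBetween (A : Set V) B) (ht : 3 ≤ t) (hA : t ≤ 2 * #A)
    (hB : t ≤ 2 * #B + 1) : G.IsClique (A : Set V) := by
  intro d hd e he hne
  by_contra hde
  exact hfree (pathPlus_isContained_of_isCompleteBetween hAB hd he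
    ((compl_adj ..).2 ⟨hne, hde⟩) ht hA hB)

end CompleteBetween

section Search

variable {V : Type*} {G : SimpleGraph V} {D S U : Finset V} {c y : V}
  {p : G.Walk y c}

theorem exists_isPath_extend_of_isClique {T : Finset V} (hT : G.IsClique T)
    (hp : p.IsPath) (hdisj : ∀ v ∈ T, v ∉ p.support) {x : V} (hx : x ∈ T) (hxy : G.Adj x y) :
    ∃ (z : V) (q : G.Walk z c), q.IsPath ∧ q.length = p.length + #T ∧
      ∀ v ∈ q.support, v ∈ p.support ∨ v ∈ T := by
  classical
  induction hn : #T generalizing T y x with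
  | zero => exact absurd hx (by simp [card_eq_zero.1 hn])
  | succ n ih =>
    have hcard : #(T.erase x) = n := by rw [card_erase_of_mem hx, hn, Nat.add_sub_cancel]
    have hp' : (Walk.cons hxy p).IsPath := hp.cons (hdisj x hx)
    rcases (T.erase x).eq_empty_or_nonempty with hempty | ⟨x', hx'⟩
    · obtain rfl : n = 0 := by rw [← hcard, hempty, card_empty]
      exact ⟨x, _, hp', rfl, by grind [Walk.support_cons]⟩
    · obtain ⟨hne, hx'T⟩ := mem_erase.1 hx'
      obtain ⟨z, q, hq, hlen, hsupp⟩ := ih (T := T.erase x)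
        (hT.subset (coe_subset.2 (erase_subset x T))) hp'
        (by grind [Walk.support_cons]) hx' (hT hx'T hx hne) hcard
      refine ⟨z, q, hq, ?_, by grind [Walk.support_cons]⟩
      rw [hlen, Walk.length_cons]
      omega

/-- A state of a depth-first search of `G` inside `D`: the active path `p` runs from the current
vertex to the root, the search has finished with `S`, and has not visited `U` yet. -/
structure IsSearchState (G : SimpleGraph V) (D : Finset V) (p : G.Walk y c) (S U : Finset V) :
    Prop where
  isPath : p.IsPath
  isCompleteBetween : Gᶜ.IsCompleteBetween (S : Set V) U
  notMem_finished : ∀ v ∈ p.support, v ∉ S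
  notMem_unvisited : ∀ v ∈ p.support, v ∉ U
  mem_iff : ∀ v, v ∈ D ↔ v ∈ p.support ∨ v ∈ S ∨ v ∈ U

namespace IsSearchState

theorem disjoint (h : IsSearchState G D p S U) : Disjoint S U :=
  disjoint_coe.1 h.isCompleteBetween.disjoint

theorem card_eq (h : IsSearchState G D p S U) : p.length + 1 + #S + #U = #D := by
  classical
  have hpS : Disjoint p.support.toFinset S :=
    disjoint_left.2 fun v hv => h.notMem_finished v (List.mem_toFinset.1 hv)
  have hpU : Disjoint p.support.toFinset U :=
    disjoint_left.2 fun v hv => h.notMem_unvisited v (List.mem_toFinset.1 hv)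
  have hD : D = p.support.toFinset ∪ S ∪ U := by
    ext v
    simp only [h.mem_iff, mem_union, List.mem_toFinset, or_assoc]
  rw [hD, card_union_of_disjoint (disjoint_union_left.2 ⟨hpU, h.disjoint⟩),
    card_union_of_disjoint hpS, List.toFinset_card_of_nodup h.isPath.support_nodup,
    Walk.length_support]

variable [DecidableEq V]

theorem init (hp : p.IsPath) (hD : ∀ v ∈ p.support, v ∈ D) :
    IsSearchState G D p ∅ (D \ p.support.toFinset) where
  isPath := hp
  isCompleteBetween := by simp [IsCompleteBetween]
  notMem_finished := by simp
  notMem_unvisited := by simp +contextual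
  mem_iff v := by
    have := hD v
    simp only [notMem_empty, mem_sdiff, List.mem_toFinset]
    tauto

theorem push (h : IsSearchState G D p S U) {u : V} (hu : u ∈ U) (huy : G.Adj u y) :
    IsSearchState G D (.cons huy p) S (U.erase u) := by
  obtain ⟨hp, hSU, hpS, hpU, hD⟩ := h
  have huS : u ∉ S := disjoint_right.1 (disjoint_coe.1 hSU.disjoint) hu
  exact ⟨hp.cons fun hup => hpU u hup hu, fun _ hs _ hv => hSU hs (mem_of_mem_erase hv),
    by grind [Walk.support_cons], by grind [Walk.support_cons], by grind [Walk.support_cons]⟩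

theorem isCompleteBetween_insert (h : IsSearchState G D p S U) (hy : ∀ u ∈ U, ¬G.Adj u y) :
    Gᶜ.IsCompleteBetween (insert y S : Finset V) U := by
  have hyU : y ∉ U := h.notMem_unvisited y p.start_mem_support
  intro s hs u hu
  rcases mem_insert.1 hs with rfl | hs
  · exact (compl_adj ..).2 ⟨fun hsu => hyU (hsu ▸ hu), fun hsu => hy u hu hsu.symm⟩
  · exact h.isCompleteBetween hs hu

theorem pop {w : V} {hyw : G.Adj y w} {p : G.Walk w c}
    (h : IsSearchState G D (.cons hyw p) S U) (hy : ∀ u ∈ U, ¬G.Adj u y) :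
    IsSearchState G D p (insert y S) U := by
  have hSU := h.isCompleteBetween_insert hy
  obtain ⟨hp, -, hpS, hpU, hD⟩ := h
  obtain ⟨hp, hyp⟩ := (Walk.cons_isPath_iff ..).1 hp
  exact ⟨hp, hSU, by grind [Walk.support_cons], by grind [Walk.support_cons],
    by grind [Walk.support_cons]⟩

/-- Every step of the search lowers `#U - #S` by exactly one. -/
theorem exists_card_eq_or_isCompleteBetween (h : IsSearchState G D p S U) (hSU : #S ≤ #U) :
    (∃ (z : V) (q : G.Walk z c) (S' U' : Finset V), IsSearchState G D q S' U' ∧ #S' = #U') ∨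
      ∃ Z ⊆ D, D \ Z ⊆ U ∧ #Z ≤ #(D \ Z) ∧
        Gᶜ.IsCompleteBetween (Z : Set V) (D \ Z : Finset V) := by
  obtain ⟨n, hn⟩ := Nat.exists_eq_add_of_le hSU
  induction n generalizing y S U with
  | zero => exact .inl ⟨y, p, S, U, h, hn.symm⟩
  | succ n ih =>
    by_cases hy : ∃ u ∈ U, G.Adj u y
    · obtain ⟨u, hu, huy⟩ := hy
      have hcard := card_erase_add_one hu
      refine (ih (h.push hu huy) (by omega) (by omega)).imp_right ?_
      rintro ⟨Z, hZD, hZU, hZ⟩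
      exact ⟨Z, hZD, hZU.trans (erase_subset u U), hZ⟩
    · push Not at hy
      have hyS : y ∉ S := h.notMem_finished y p.start_mem_support
      have hcard := card_insert_of_notMem hyS
      cases p with
      | cons hyw p => exact ih (h.pop hy) (by omega) (by omega)
      | nil =>
        have hD := h.mem_iff
        simp only [Walk.support_nil, List.mem_singleton] at hD
        have hU : D \ insert c S = U := by
          have := disjoint_left.1 h.disjoint
          have := h.notMem_unvisited c (by simp)
          grind
        refine .inr ⟨insert c S, by grind, hU.subset, by rw [hU]; omega, ?_⟩
        rw [hU]
        exact h.isCompleteBetween_insert hy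

end IsSearchState

end Search

section Triangle

variable {V : Type*} {G : SimpleGraph V} {D S U T Z : Finset V} {a b c x y : V}
  {p : G.Walk y c} {t : ℕ}

theorem pathPlus_isContained_of_isPath_of_isClique (hab : G.Adj a b) (hac : G.Adj a c)
    (hbc : G.Adj b c) (hp : p.IsPath) (hpD : ∀ v ∈ p.support, v ∈ D) (hT : G.IsClique T)
    (hTD : T ⊆ D) (hTp : ∀ v ∈ T, v ∉ p.support) (ha : a ∉ D) (hb : b ∉ D) (hx : x ∈ T)
    (hxy : G.Adj x y) (ht : t ≤ p.length + #T + 3) : pathPlus t ⊑ G := by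
  obtain ⟨z, q, hq, hlen, hsupp⟩ := exists_isPath_extend_of_isClique hT hp hTp hx hxy
  have hqD : ∀ v ∈ q.support, v ∈ D := fun v hv => (hsupp v hv).elim (hpD v) fun h => hTD h
  exact pathPlus_isContained_of_isPath hab hac hbc hq (fun h => ha (hqD a h))
    (fun h => hb (hqD b h)) (by omega)

theorem IsSearchState.pathPlus_isContained_or_of_card_eq (h : IsSearchState G D p S U)
    (hSU : #S = #U) (hab : G.Adj a b) (hac : G.Adj a c) (hbc : G.Adj b c) (ha : a ∉ D)
    (hb : b ∉ D) (ht : 3 ≤ t) (hD : 2 * t ≤ #D + 3) :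
    pathPlus t ⊑ G ∨ pathPlus t ⊑ Gᶜ := by
  classical
  by_contra hfree
  obtain ⟨hG, hGc⟩ := not_or.1 hfree
  have hpD : ∀ v ∈ p.support, v ∈ D := fun v hv => (h.mem_iff v).2 (.inl hv)
  have hp : p.length + 3 < t := by
    by_contra! hp
    exact hG (pathPlus_isContained_of_isPath hab hac hbc h.isPath (fun hap => ha (hpD a hap))
      (fun hbp => hb (hpD b hbp)) hp)
  have hcard := h.card_eq
  have hS : G.IsClique S :=
    isClique_of_isCompleteBetween_compl hGc h.isCompleteBetween ht (by omega) (by omega)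
  have hU : G.IsClique U :=
    isClique_of_isCompleteBetween_compl hGc h.isCompleteBetween.symm ht (by omega) (by omega)
  have hyS : ∀ x ∈ S, ¬G.Adj x y := fun x hx hxy =>
    hG (pathPlus_isContained_of_isPath_of_isClique hab hac hbc h.isPath hpD hS
      (fun v hv => (h.mem_iff v).2 (.inr (.inl hv))) (fun v hv hvp => h.notMem_finished v hvp hv)
      ha hb hx hxy (by omega))
  have hyU : ∀ x ∈ U, ¬G.Adj x y := fun x hx hxy =>
    hG (pathPlus_isContained_of_isPath_of_isClique hab hac hbc h.isPath hpD hU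
      (fun v hv => (h.mem_iff v).2 (.inr (.inr hv))) (fun v hv hvp => h.notMem_unvisited v hvp hv)
      ha hb hx hxy (by omega))
  have hyS' : y ∉ S := h.notMem_finished y p.start_mem_support
  have hinsert : G.IsClique (insert y S : Finset V) :=
    isClique_of_isCompleteBetween_compl hGc (h.isCompleteBetween_insert hyU) ht
      (by rw [card_insert_of_notMem hyS']; omega) (by omega)
  obtain ⟨x, hx⟩ : S.Nonempty := card_pos.1 (by omega)
  exact hyS x hx
    (hinsert (mem_insert_of_mem hx) (mem_insert_self y S) (ne_of_mem_of_not_mem hx hyS'))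

theorem pathPlus_isContained_or_of_isCompleteBetween_compl (hZ : Gᶜ.IsCompleteBetween (Z : Set V) U)
    (hZU : #Z ≤ #U) (hcard : 2 * t ≤ #Z + #U + 3) (htZ : t ≤ #Z + 3) (hab : G.Adj a b)
    (hac : G.Adj a c) (hbc : G.Adj b c) (hc : c ∈ Z) (ha : a ∉ Z) (hb : b ∉ Z) (ht : 5 ≤ t) :
    pathPlus t ⊑ G ∨ pathPlus t ⊑ Gᶜ := by
  classical
  by_contra hfree
  obtain ⟨hG, hGc⟩ := not_or.1 hfree
  have hUclique : G.IsClique U :=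
    isClique_of_isCompleteBetween_compl hGc hZ.symm (by omega) (by omega) (by omega)
  have hUt : #U < t := by
    by_contra! hUt
    exact hG (pathPlus_isContained_of_isClique hUclique hUt)
  have hZclique : G.IsClique Z :=
    isClique_of_isCompleteBetween_compl hGc hZ (by omega) (by omega) (by omega)
  have hZc := card_erase_add_one hc
  obtain ⟨x, hx⟩ : (Z.erase c).Nonempty := card_pos.1 (by omega)
  obtain ⟨hxc, hxZ⟩ := mem_erase.1 hx
  exact hG (pathPlus_isContained_of_isPath_of_isClique (p := .nil) (D := Z) hab hac hbc .nil
    (by simpa using hc) (hZclique.subset (coe_subset.2 (erase_subset c Z))) (erase_subset c Z)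
    (by simp +contextual) ha hb hx (hZclique hxZ hc hxc) (by rw [Walk.length_nil]; omega))

theorem pathPlus_four_isContained_of_isNClique (hT : G.IsNClique 3 T) (hc : c ∈ T) (hx : x ∉ T)
    (hxc : G.Adj x c) : pathPlus 4 ⊑ G := by
  classical
  obtain ⟨a, b, hab, hTc⟩ : ∃ a b, a ≠ b ∧ T.erase c = {a, b} :=
    card_eq_two.1 (by rw [card_erase_of_mem hc, hT.card_eq])
  obtain ⟨hac, haT⟩ : a ≠ c ∧ a ∈ T := mem_erase.1 (by simp [hTc])
  obtain ⟨hbc, hbT⟩ : b ≠ c ∧ b ∈ T := mem_erase.1 (by simp [hTc])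
  have hax : a ≠ x := ne_of_mem_of_not_mem haT hx
  have hbx : b ≠ x := ne_of_mem_of_not_mem hbT hx
  exact pathPlus_isContained_of_isPath (hT.isClique haT hbT hab) (hT.isClique haT hc hac)
    (hT.isClique hbT hc hbc) hxc.isPath_toWalk (by simp [hac, hax]) (by simp [hbc, hbx]) le_rfl

end Triangle

section UpperBound

variable {V : Type*} [Fintype V] {G : SimpleGraph V} {k : ℕ}

theorem pathPlus_succ_isContained_or (hk : 4 ≤ k) (hV : 2 * k + 1 ≤ Fintype.card V)
    (h : pathPlus k ⊑ G) : pathPlus (k + 1) ⊑ G ∨ pathPlus (k + 1) ⊑ Gᶜ := by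
  classical
  obtain ⟨a, b, c, d, p, hab, hac, hbc, hp, hap, hbp, hlen⟩ :=
    exists_isPath_of_pathPlus_isContained (by omega) h
  let D : Finset V := {a, b}ᶜ
  have ha : a ∉ D := by simp [D]
  have hb : b ∉ D := by simp [D]
  have hD : #D + 2 = Fintype.card V := by
    rw [← card_pair hab.ne, card_compl_add_card]
  have hpD : ∀ v ∈ p.support, v ∈ D := by
    intro v hv
    rw [mem_compl, mem_insert, mem_singleton, not_or]
    exact ⟨ne_of_mem_of_not_mem hv hap, ne_of_mem_of_not_mem hv hbp⟩
  have hstate := IsSearchState.init hp hpD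
  rcases hstate.exists_card_eq_or_isCompleteBetween (by simp) with
    ⟨z, q, S, U, hq, hSU⟩ | ⟨Z, hZD, hZp, hcard, hZ⟩
  · exact hq.pathPlus_isContained_or_of_card_eq hSU hab hac hbc ha hb (by omega) (by omega)
  · have hpZ : p.support.toFinset ⊆ Z := by
      intro v hv
      by_contra hvZ
      have hvD := hpD v (List.mem_toFinset.1 hv)
      exact (mem_sdiff.1 (hZp (mem_sdiff.2 ⟨hvD, hvZ⟩))).2 hv
    have hlenZ : p.length + 1 ≤ #Z := by
      rw [← Walk.length_support, ← List.toFinset_card_of_nodup hp.support_nodup]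
      exact card_le_card hpZ
    have hDcard := card_sdiff_add_card_eq_card hZD
    exact pathPlus_isContained_or_of_isCompleteBetween_compl hZ hcard (by omega) (by omega) hab hac
      hbc (hpZ (by simp)) (fun h => ha (hZD h)) (fun h => hb (hZD h)) (by omega)

theorem not_cliqueFree_three_or_compl (hV : 6 ≤ Fintype.card V) :
    ¬G.CliqueFree 3 ∨ ¬Gᶜ.CliqueFree 3 := by
  classical
  by_contra! h
  obtain ⟨hG, hGc⟩ := h
  obtain ⟨v⟩ : Nonempty V := Fintype.card_pos_iff.1 (by omega)
  have hdeg : ∀ (H : SimpleGraph V) [Fintype (H.neighborSet v)],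
      H.CliqueFree 3 → Hᶜ.CliqueFree 3 → H.degree v ≤ 2 := by
    intro H _ hH hHc
    have hind := H.isIndepSet_neighborSet_of_triangleFree hH v
    by_contra! hlt
    rw [← isClique_compl, ← coe_neighborFinset] at hind
    exact (hHc.mono hlt) _ ⟨hind, rfl⟩
  have hdegG := hdeg G hG hGc
  have hdegGc := hdeg Gᶜ hGc (by rwa [compl_compl])
  have hsum := G.degree_compl v
  have hlt := G.degree_lt_card_verts v
  omega

theorem pathPlus_four_isContained_or (hV : 7 ≤ Fintype.card V) (h : ¬G.CliqueFree 3) :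
    pathPlus 4 ⊑ G ∨ pathPlus 4 ⊑ Gᶜ := by
  classical
  by_contra hfree
  obtain ⟨hG, hGc⟩ := not_or.1 hfree
  obtain ⟨T, hT⟩ : ∃ T, G.IsNClique 3 T := by simpa [CliqueFree] using h
  have hTU : Gᶜ.IsCompleteBetween (Tᶜ : Finset V) (T : Set V) := by
    intro u hu c hc
    have hu : u ∉ T := mem_compl.1 hu
    exact (compl_adj ..).2 ⟨(ne_of_mem_of_not_mem hc hu).symm, fun huc =>
      hG (pathPlus_four_isContained_of_isNClique hT hc hu huc)⟩
  have hcard := card_compl_add_card T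
  rw [hT.card_eq] at hcard
  have hU : G.IsClique (Tᶜ : Finset V) :=
    isClique_of_isCompleteBetween_compl hGc hTU (by norm_num) (by omega) (by rw [hT.card_eq]; omega)
  exact hG (pathPlus_isContained_of_isClique hU (by omega))

theorem pathPlus_isContained_or (hk : 4 ≤ k) (hV : 2 * k - 1 ≤ Fintype.card V) :
    pathPlus k ⊑ G ∨ pathPlus k ⊑ Gᶜ := by
  induction k, hk using Nat.le_induction with
  | base =>
    rcases not_cliqueFree_three_or_compl (G := G) (by omega) with h | h
    · exact pathPlus_four_isContained_or hV h
    · simpa [or_comm] using pathPlus_four_isContained_or hV h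
  | succ k hk ih =>
    rcases ih (by omega) with h | h
    · exact pathPlus_succ_isContained_or hk (by omega) h
    · simpa [or_comm] using pathPlus_succ_isContained_or hk (by omega) h

end UpperBound

theorem theorem4p1 (t : ℕ) (ht : 4 ≤ t) :
    IsRamseyNumber (pathPlus t) (pathPlus t) (2 * t - 1) := by
  refine ⟨fun R => pathPlus_isContained_or ht (Fintype.card_fin _).ge, fun n hn => ?_⟩
  by_contra! hlt
  refine not_ramseyArrows_of_connected (c := 2) (pathPlus_connected (by omega))
    (not_colorable_two_pathPlus (by omega)) ?_ hn
  rw [Fintype.card_fin]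
  omega
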